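/- Let $\mathcal N=\{1,\dots,n\}$ be a set of agents, $\mathcal G=(\mathcal N,\mathcal E)$ a directed graph, where $(j,i)\in\mathcal E$ means that agent $i$ can receive information from agent $j$, and let $\mathcal L\subseteq\mathcal N$ (the leaders), $\mathcal F=\mathcal N\setminus\mathcal L$ (the followers), and $v_d\in\mathbb R^m$. Let $T>0$. For $(j,i)\in\mathcal E$ and $k\in\mathbb Z_+=\{0,1,\dots\}$ let $\tau^{(j,i)}_k\in[0,+\infty]$: the information sent by $j$ at time $kT$ is available to $i$ from time $kT+\tau_k^{(j,i)}$ on (never, if $\tau_k^{(j,i)}=+\infty$). Let $$k_{ij}(t):=\max\{k\in\mathbb Z_+:\ kT+\tau^{(j,i)}_k\le t\},$$ with $k_{ij}(t):=-\infty$ if this set is empty. Assumption 1: for each $(j,i)\in\mathcal E$ there exist $k^*\in\mathbb N$, $h\ge 0$ and a strictly increasing sequence $k_0<k_1<\cdots$ in $\mathbb Z_+$ such that $k_0\le k^*$, $k_{l+1}-k_l\le k^*$ for all $l\ge 0$, and $\tau^{(j,i)}_{k_l}\le h$ for all $l\ge 0$. Consider the algorithm, with arbitrary initial values $\hat v_{d_i}(0)\in\mathbb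 R^m$ for $i\in\mathcal F$, $$\hat v_{d_i}(\sigma)\equiv v_d\ \ (i\in\mathcal L),\qquad \hat v_{d_i}(\sigma+1)=\frac1{|N_i(\sigma)|}\sum_{j\in N_i(\sigma)}\hat v_{d_{ij}}(\sigma)\ \ (i\in\mathcal F),\qquad \sigma\in\mathbb Z_+,$$ where $\hat v_{d_{ii}}(\sigma)=\hat v_{d_i}(\sigma)$, $\hat v_{d_{ij}}(\sigma)=\hat v_{d_j}(k_{ij}(\sigma T))$ for $j\ne i$, and $$N_i(\sigma)=\{i\}\cup\{j:(j,i)\in\mathcal E,\ k_{ij}(\sigma T)>k_{ij}((\sigma-1)T)\}.$$ Consider also, for $t\ge 0$, $\bar v_{d_i}\equiv v_d$ for $i\in\mathcal L$, and for $i\in\mathcal F$ a $\mathcal C^1$ solution (with arbitrary initial values) of $$\ddot{\bar v}_{d_i}=-k_i^d\,\dot{\bar v}_{d_i}-k_i^p\bigl(\bar v_{d_i}-\hat v_{d_i}(\lfloor t/T\rfloor)\bigr),\qquad k_i^d,k_i^p>0,$$ the equation being required at all $t>0$ that are not multiples of $T$. Suppose that Assumption 1 holds. Call $\mathcal G$ rooted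 at $r$ if there is a directed path from $r$ to every other node, and rooted if it is rooted at some node. (a) If $\mathcal L\ne\emptyset$ and $\mathcal G$ is rooted at some $r\in\mathcal L$, then $\hat v_{d_i}(\sigma)\to v_c:=v_d$ as $\sigma\to+\infty$ for all $i\in\mathcal N$. (b) If $\mathcal L=\emptyset$ and $\mathcal G$ is rooted, then there is $v_c\in\mathbb R^m$ such that $\hat v_{d_i}(\sigma)\to v_c$ as $\sigma\to+\infty$ for all $i\in\mathcal N$. In both cases, $\bar v_{d_i}(t)$ and $\dot{\bar v}_{d_i}(t)$ are uniformly bounded on $[0,\infty)$ and $\bar v_{d_i}(t)\to v_c$ as $t\to+\infty$, for all $i\in\mathcal N$. -/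

import Mathlib

open Filter Topology Set
open scoped ENNReal

noncomputable section

/-- The directed graph `G` is rooted at `r`: there is a directed path from `r` to every other node.
`G.Adj j i` is the edge `(j, i)`, leaving `j` and directed toward `i`. -/
def IsRootedAt {n : ℕ} (G : Digraph (Fin n)) (r : Fin n) : Prop :=
  ∀ i, i ≠ r → Relation.TransGen G.Adj r i

/-- The time stamps of the messages sent over one link at the instants `k * T` (the `k`-th one with
delay `τ k`, where `τ k = ⊤` means that it was not sent or is lost) that are delivered by time `t`. -/
def deliveredStamps (T : ℝ) (τ : ℕ → ℝ≥0∞) (t : ℝ) : Set ℕ :=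
  {k | τ k ≠ ⊤ ∧ (k : ℝ) * T + (τ k).toReal ≤ t}

open Classical in
/-- The largest time stamp delivered over one link by time `t`; it is `⊥` as long as nothing has been
delivered. -/
def latestStamp (T : ℝ) (τ : ℕ → ℝ≥0∞) (t : ℝ) : WithBot ℕ :=
  if (deliveredStamps T τ t).Nonempty then ((sSup (deliveredStamps T τ t) : ℕ) : WithBot ℕ) else ⊥

theorem bddAbove_deliveredStamps {T : ℝ} (hT : 0 < T) (τ : ℕ → ℝ≥0∞) (t : ℝ) :
    BddAbove (deliveredStamps T τ t) := by
  refine ⟨⌊t / T⌋₊, ?_⟩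
  rintro k ⟨-, hk⟩
  have h0 : 0 ≤ (τ k).toReal := ENNReal.toReal_nonneg
  exact Nat.le_floor ((le_div_iff₀ hT).2 (by linarith))

/-- For a positive sampling period, `latestStamp` is the maximum of the delivered time stamps. -/
theorem latestStamp_eq_coe_iff {T : ℝ} (hT : 0 < T) (τ : ℕ → ℝ≥0∞) (t : ℝ) (k : ℕ) :
    latestStamp T τ t = (k : WithBot ℕ) ↔ IsGreatest (deliveredStamps T τ t) k := by
  unfold latestStamp
  constructor
  · intro h
    split_ifs at h with hne
    · have hk : sSup (deliveredStamps T τ t) = k := WithBot.coe_injective h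
      rw [← hk]
      exact ⟨Nat.sSup_mem hne (bddAbove_deliveredStamps hT τ t),
        fun x hx => le_csSup (bddAbove_deliveredStamps hT τ t) hx⟩
    · exact absurd h.symm (WithBot.coe_ne_bot)
  · intro h
    rw [if_pos h.nonempty, h.csSup_eq]

/-- The assumption on the communication process. For every edge `(j, i)` there are `kstar`, `h ≥ 0`
and a strictly increasing sequence of sampling instants, the first one at most `kstar` and with gaps
at most `kstar`, at which `j` sends data to `i` that is delivered with delay at most `h`. The delays
at all other instants are arbitrary, possibly infinite. -/
def CommunicationAssumption {n : ℕ} (G : Digraph (Fin n)) (τ : Fin n → Fin n → ℕ → ℝ≥0∞) : Prop :=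
  ∀ j i, G.Adj j i → ∃ (kstar : ℕ) (h : ℝ) (K : ℕ → ℕ), 0 ≤ h ∧ StrictMono K ∧
    K 0 ≤ kstar ∧ (∀ l, K (l + 1) ≤ K l + kstar) ∧ ∀ l, τ j i (K l) ≤ ENNReal.ofReal h

open Classical in
/-- The set of agents whose data is used by agent `i` at instant `σ * T`: agent `i` itself, and every
neighbour `j` whose most recent data delivered at `σ * T` is newer than that at `(σ - 1) * T`. -/
def updateSet {n : ℕ} (G : Digraph (Fin n)) (T : ℝ) (τ : Fin n → Fin n → ℕ → ℝ≥0∞)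
    (i : Fin n) (σ : ℕ) : Finset (Fin n) :=
  insert i (Finset.univ.filter fun j => G.Adj j i ∧
    latestStamp T (τ j i) (((σ : ℝ) - 1) * T) < latestStamp T (τ j i) ((σ : ℝ) * T))

/-- The most recent estimate of agent `j` available to agent `i` at instant `σ * T`. It is used only
for `j ∈ updateSet G T τ i σ`; for such `j ≠ i` the latest stamp is not `⊥`. -/
def receivedEstimate {n m : ℕ} (T : ℝ) (τ : Fin n → Fin n → ℕ → ℝ≥0∞)
    (vhat : Fin n → ℕ → EuclideanSpace ℝ (Fin m)) (i j : Fin n) (σ : ℕ) :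
    EuclideanSpace ℝ (Fin m) :=
  if j = i then vhat i σ else vhat j ((latestStamp T (τ j i) ((σ : ℝ) * T)).unbotD 0)

/-- `vhat` is a trajectory of the discrete-time consensus algorithm with set of leaders `L`: leaders
hold `vd`, and every follower averages over its update set. The initial values of the followers are
arbitrary. -/
structure IsConsensusTrajectory {n m : ℕ} (G : Digraph (Fin n)) (L : Set (Fin n)) (T : ℝ)
    (τ : Fin n → Fin n → ℕ → ℝ≥0∞) (vd : EuclideanSpace ℝ (Fin m))
    (vhat : Fin n → ℕ → EuclideanSpace ℝ (Fin m)) : Prop where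
  leader : ∀ i ∈ L, ∀ σ, vhat i σ = vd
  follower : ∀ i ∉ L, ∀ σ, vhat i (σ + 1) =
    ((updateSet G T τ i σ).card : ℝ)⁻¹ •
      ∑ j ∈ updateSet G T τ i σ, receivedEstimate T τ vhat i j σ

/-- `vbar` is the second-order filtered estimate on `[0, ∞)` driven by `vhat`, with gains `kd`, `kp`.
For followers it is continuously differentiable and solves the filter equation at every time which is
not a sampling instant (the input jumps at the sampling instants). Its initial values are
arbitrary. -/
structure IsFilteredEstimate {n m : ℕ} (L : Set (Fin n)) (T : ℝ) (kd kp : Fin n → ℝ)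
    (vd : EuclideanSpace ℝ (Fin m)) (vhat : Fin n → ℕ → EuclideanSpace ℝ (Fin m))
    (vbar : Fin n → ℝ → EuclideanSpace ℝ (Fin m)) : Prop where
  leader : ∀ i ∈ L, ∀ t, 0 ≤ t → vbar i t = vd
  contDiffOn : ∀ i ∉ L, ContDiffOn ℝ 1 (vbar i) (Ici 0)
  ode : ∀ i ∉ L, ∀ t, 0 < t → (∀ σ : ℕ, t ≠ (σ : ℝ) * T) →
    HasDerivAt (derivWithin (vbar i) (Ici 0))
      (-(kd i • derivWithin (vbar i) (Ici 0) t) - kp i • (vbar i t - vhat i ⌊t / T⌋₊)) t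

/-- All the `vbar i` and their first derivatives are uniformly bounded on `[0, ∞)`. -/
def UniformlyBoundedWithDeriv {n m : ℕ} (vbar : Fin n → ℝ → EuclideanSpace ℝ (Fin m)) : Prop :=
  ∃ C : ℝ, ∀ i, ∀ t, 0 ≤ t → ‖vbar i t‖ ≤ C ∧ ‖derivWithin (vbar i) (Ici 0) t‖ ≤ C

end

/-!
Why the estimates converge: the communication assumption makes delays effectively bounded. For some
`D`, valid for all edges, the data that is used is at most `D` periods old, and fresh data arrives on
every edge at least once in any `D + 1` consecutive steps
(`CommunicationAssumption.exists_bound`). Each coordinate of the estimates is then a process of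
averaging with delays bounded by `D` (`IsDelayedAveraging`), in which a leader, averaging over itself
alone, copies the root.

In such a process, an interval that contains all values of a time window of length `D` contains all
later values. The root lies at least half the width of this interval away from one of its ends.
Since each node gives its own current value weight at least `1 / n`, and each fresh message weight at
least `1 / n`, this margin decays at most geometrically in time while it spreads along the edges, so
after a fixed time every node has a margin of at least a fixed fraction of the width
(`IsDelayedAveraging.exists_raise_lower_bound`). Hence the interval contracts by a fixed factor in a
fixed time (`IsDelayedAveraging.exists_contraction`), which gives a common limit. If there are
leaders, the root is one of them, and the limit is its constant value.

For the filter, put `e = vbar - vc`, `p` its derivative and `w = vhat - vc`. The function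
`‖p + kd • e‖ ^ 2 + ‖p‖ ^ 2 + 2 * kp * ‖e‖ ^ 2` has a right derivative at every time, sampling instants
included, and this is at most `-c` times the function plus a constant times `‖w‖ ^ 2`. Grönwall's
inequality with a negative rate then yields boundedness, because `w` is bounded, and convergence,
because `w` tends to zero (`damped_oscillator_bounded_and_tendsto`).
-/

/-! ### Averaging with bounded delays -/

/-- The average of numbers that are at least `a`, one of which is at least `a + e`, exceeds `a` by
at least `e` divided by the size of the whole index type. -/
theorem add_inv_card_mul_le_average {ι : Type*} [Fintype ι] {N : Finset ι} {f : ι → ℝ} {a e : ℝ}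
    (ha : ∀ j ∈ N, a ≤ f j) {j : ι} (hj : j ∈ N) (he : 0 ≤ e) (hje : a + e ≤ f j) :
    a + (Fintype.card ι : ℝ)⁻¹ * e ≤ (N.card : ℝ)⁻¹ * ∑ k ∈ N, f k := by
  have hpos : (0 : ℝ) < N.card := by exact_mod_cast Finset.card_pos.2 ⟨j, hj⟩
  have hle : (N.card : ℝ) ≤ Fintype.card ι := by exact_mod_cast Finset.card_le_univ N
  have hsum : f j - a ≤ ∑ k ∈ N, (f k - a) :=
    Finset.single_le_sum (f := fun k => f k - a) (fun k hk => sub_nonneg.2 (ha k hk)) hj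
  rw [Finset.sum_sub_distrib, Finset.sum_const, nsmul_eq_mul] at hsum
  calc a + (Fintype.card ι : ℝ)⁻¹ * e ≤ a + (N.card : ℝ)⁻¹ * e := by gcongr
    _ = (N.card : ℝ)⁻¹ * (N.card * a + e) := by field_simp
    _ ≤ (N.card : ℝ)⁻¹ * ∑ k ∈ N, f k := by gcongr; linarith

/-- A real-valued trajectory `x` in which every node `i` averages over the set `N i σ` of nodes,
using the value of node `j` at the time `κ i j σ`. Delays are at most `D`, a node uses its own value
without delay, and every node `j` that does not simply copy the root `r` hears from each of its
in-neighbours at least once in any `D + 1` consecutive steps. -/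
structure IsDelayedAveraging {ι : Type*} (Adj : ι → ι → Prop) (r : ι) (D : ℕ)
    (N : ι → ℕ → Finset ι) (κ : ι → ι → ℕ → ℕ) (x : ι → ℕ → ℝ) : Prop where
  self_mem : ∀ i σ, i ∈ N i σ
  self_time : ∀ i σ, κ i i σ = σ
  time_le : ∀ i σ, ∀ j ∈ N i σ, κ i j σ ≤ σ
  le_time : ∀ i σ, ∀ j ∈ N i σ, σ ≤ κ i j σ + D
  step : ∀ i σ, x i (σ + 1) = ((N i σ).card : ℝ)⁻¹ * ∑ j ∈ N i σ, x j (κ i j σ)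
  contact : ∀ i j, Adj i j → (∀ σ, x j σ = x r σ) ∨ ∀ s, ∃ q, s ≤ q ∧ q ≤ s + D ∧ i ∈ N j q

namespace IsDelayedAveraging

variable {ι : Type*} {Adj : ι → ι → Prop} {r : ι} {D : ℕ} {N : ι → ℕ → Finset ι}
  {κ : ι → ι → ℕ → ℕ} {x : ι → ℕ → ℝ}

theorem neg (hx : IsDelayedAveraging Adj r D N κ x) :
    IsDelayedAveraging Adj r D N κ (fun i σ => -x i σ) where
  self_mem := hx.self_mem
  self_time := hx.self_time
  time_le := hx.time_le
  le_time := hx.le_time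
  step i σ := by simp [hx.step i σ, Finset.sum_neg_distrib]
  contact i j hij := (hx.contact i j hij).imp_left fun h σ => by simp [h σ]

/-- A lower bound valid throughout a time window of length `D` remains valid forever. -/
theorem lower_bound_forever [Fintype ι] (hx : IsDelayedAveraging Adj r D N κ x) {a : ℝ} {σ : ℕ}
    (h : ∀ i s, σ ≤ s + D → s ≤ σ → a ≤ x i s) : ∀ i s, σ ≤ s + D → a ≤ x i s := by
  intro i s
  induction s using Nat.strong_induction_on generalizing i with
  | _ s ih =>
    intro hs
    rcases le_or_gt s σ with hsσ | hsσ
    · exact h i s hs hsσ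
    obtain ⟨s, rfl⟩ : ∃ k, s = k + 1 := ⟨s - 1, by omega⟩
    have key := add_inv_card_mul_le_average (N := N i s) (f := fun j => x j (κ i j s)) (a := a)
      (e := 0) (fun j hj => ih _ (by have := hx.time_le i s j hj; omega) j
        (by have := hx.le_time i s j hj; omega)) (hx.self_mem i s) le_rfl
      (by
        simp only [add_zero, hx.self_time]
        exact ih s (by omega) i (by omega))
    rw [hx.step]
    simpa using key

theorem step_lower_bound [Fintype ι] (hx : IsDelayedAveraging Adj r D N κ x) {a e : ℝ} {σ q : ℕ}
    (ha : ∀ i s, σ ≤ s + D → a ≤ x i s) (hq : σ ≤ q) (he : 0 ≤ e) {i j : ι} (hj : j ∈ N i q)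
    (hje : a + e ≤ x j (κ i j q)) : a + (Fintype.card ι : ℝ)⁻¹ * e ≤ x i (q + 1) := by
  rw [hx.step]
  exact add_inv_card_mul_le_average (f := fun j => x j (κ i j q))
    (fun k hk => ha k _ (hq.trans (hx.le_time i q k hk))) hj he hje

/-- A margin over a lower bound decays at most geometrically, because every node gives its own
current value at least the weight `(card ι)⁻¹`. -/
theorem margin_persists [Fintype ι] (hx : IsDelayedAveraging Adj r D N κ x) {a δ : ℝ} {σ t : ℕ}
    (ha : ∀ i s, σ ≤ s + D → a ≤ x i s) (hδ : 0 ≤ δ) {i : ι}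
    (hi : a + (Fintype.card ι : ℝ)⁻¹ ^ t * δ ≤ x i (σ + t)) :
    ∀ s, t ≤ s → a + (Fintype.card ι : ℝ)⁻¹ ^ s * δ ≤ x i (σ + s) := by
  intro s hs
  induction s, hs using Nat.le_induction with
  | base => exact hi
  | succ s _ ih =>
    have := hx.step_lower_bound (e := (Fintype.card ι : ℝ)⁻¹ ^ s * δ) ha (Nat.le_add_right σ s)
      (by positivity) (hx.self_mem i (σ + s)) (by rw [hx.self_time]; exact ih)
    rw [pow_succ', mul_assoc]
    exact this

/-- A margin of the root over a common lower bound reaches each node after a delay `t` which depends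
neither on the trajectory nor on the starting time. -/
theorem exists_time_margin [Fintype ι] (Adj : ι → ι → Prop) (r : ι) (D : ℕ) (N : ι → ℕ → Finset ι)
    (κ : ι → ι → ℕ → ℕ) {i : ι} (hi : Relation.ReflTransGen Adj r i) :
    ∃ t, ∀ x, IsDelayedAveraging Adj r D N κ x → ∀ (a δ : ℝ) (σ : ℕ),
      (∀ i s, σ ≤ s + D → a ≤ x i s) → 0 ≤ δ → a + δ ≤ x r σ →
      ∀ s, t ≤ s → a + (Fintype.card ι : ℝ)⁻¹ ^ s * δ ≤ x i (σ + s) := by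
  induction hi with
  | refl =>
    exact ⟨0, fun x hx a δ σ ha hδ hr => hx.margin_persists ha hδ (by simpa using hr)⟩
  | @tail i j _ hij ih =>
    obtain ⟨t, ht⟩ := ih
    refine ⟨t + 2 * D + 1, fun x hx a δ σ ha hδ hr s hs => ?_⟩
    rcases hx.contact i j hij with hcopy | hcontact
    · rw [hcopy]
      exact hx.margin_persists (t := 0) ha hδ (by simpa using hr) s (Nat.zero_le s)
    -- Starting the search `D` steps later makes the message received by `j` newer than `σ + t`.
    obtain ⟨q, hq, hq', hmem⟩ := hcontact (σ + t + D)
    have h1 := hx.le_time j q i hmem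
    have h2 := hx.time_le j q i hmem
    obtain ⟨k, hk⟩ : ∃ k, κ j i q = σ + k := ⟨κ j i q - σ, by omega⟩
    obtain ⟨p, rfl⟩ : ∃ p, q = σ + p := ⟨q - σ, by omega⟩
    have h3 := ht x hx a δ σ ha hδ hr k (by omega)
    rw [← hk] at h3
    have h4 := hx.step_lower_bound ha (by omega) (by positivity) hmem h3
    have hcard : (1 : ℝ) ≤ Fintype.card ι := by
      exact_mod_cast Fintype.card_pos_iff.2 ⟨r⟩
    have h5 : (Fintype.card ι : ℝ)⁻¹ ^ (p + 1) ≤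
        (Fintype.card ι : ℝ)⁻¹ * (Fintype.card ι : ℝ)⁻¹ ^ k := by
      rw [← pow_succ']
      exact pow_le_pow_of_le_one (by positivity) (inv_le_one_of_one_le₀ hcard) (by omega)
    refine hx.margin_persists (t := p + 1) ha hδ ?_ s (by omega)
    calc a + (Fintype.card ι : ℝ)⁻¹ ^ (p + 1) * δ
        ≤ a + (Fintype.card ι : ℝ)⁻¹ * ((Fintype.card ι : ℝ)⁻¹ ^ k * δ) := by
          rw [← mul_assoc]; gcongr
      _ ≤ x j (σ + (p + 1)) := h4

/-- If the root exceeds a common lower bound by `δ`, then after a fixed time the common lower bound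
can be raised by a fixed fraction of `δ`. -/
theorem exists_raise_lower_bound [Fintype ι] (Adj : ι → ι → Prop) (r : ι) (D : ℕ)
    (N : ι → ℕ → Finset ι) (κ : ι → ι → ℕ → ℕ) (hroot : ∀ i, Relation.ReflTransGen Adj r i) :
    ∃ (S : ℕ) (c : ℝ), 0 < c ∧ c ≤ 1 ∧ ∀ x, IsDelayedAveraging Adj r D N κ x → ∀ (a δ : ℝ) (σ : ℕ),
      (∀ i s, σ ≤ s + D → a ≤ x i s) → 0 ≤ δ → a + δ ≤ x r σ →
      ∀ i s, σ + S ≤ s + D → a + c * δ ≤ x i s := by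
  choose t ht using fun i => exists_time_margin Adj r D N κ (hroot i)
  have hcard : (1 : ℝ) ≤ Fintype.card ι := by exact_mod_cast Fintype.card_pos_iff.2 ⟨r⟩
  have hle : ((Fintype.card ι : ℝ)⁻¹) ≤ 1 := inv_le_one_of_one_le₀ hcard
  have hpos : 0 < ((Fintype.card ι : ℝ)⁻¹) := by positivity
  refine ⟨Finset.univ.sup t + D, (Fintype.card ι : ℝ)⁻¹ ^ (Finset.univ.sup t + D), by positivity,
    pow_le_one₀ hpos.le hle, fun x hx a δ σ ha hδ hr => ?_⟩
  refine hx.lower_bound_forever fun i s hs hs' => ?_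
  have hi : t i ≤ Finset.univ.sup t := Finset.le_sup (Finset.mem_univ i)
  obtain ⟨p, rfl⟩ : ∃ p, s = σ + p := ⟨s - σ, by omega⟩
  refine le_trans ?_ (ht i x hx a δ σ ha hδ hr p (by omega))
  have := pow_le_pow_of_le_one hpos.le hle (show p ≤ Finset.univ.sup t + D by omega)
  gcongr

/-- The range of the trajectory over all late times shrinks by a fixed factor in a fixed time: the
root is at least half the width away from one of the ends of the range, and that end moves. -/
theorem exists_contraction [Fintype ι] (hx : IsDelayedAveraging Adj r D N κ x)
    (hroot : ∀ i, Relation.ReflTransGen Adj r i) :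
    ∃ (S : ℕ) (c : ℝ), 0 ≤ c ∧ c < 1 ∧ ∀ (a b : ℝ) (σ : ℕ),
      (∀ i s, σ ≤ s + D → x i s ∈ Icc a b) →
      ∃ a' b', b' - a' ≤ c * (b - a) ∧ ∀ i s, σ + S ≤ s + D → x i s ∈ Icc a' b' := by
  obtain ⟨S, c, hc, hc1, h⟩ := exists_raise_lower_bound Adj r D N κ hroot
  refine ⟨S, 1 - c / 2, by linarith, by linarith, fun a b σ hab => ?_⟩
  have hr := hab r σ (by omega)
  have hw : 0 ≤ (b - a) / 2 := by linarith [hr.1, hr.2]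
  rcases le_total ((a + b) / 2) (x r σ) with hmid | hmid
  · have h1 := h x hx a ((b - a) / 2) σ (fun i s hs => (hab i s hs).1) hw (by linarith)
    exact ⟨a + c * ((b - a) / 2), b, by linarith,
      fun i s hs => ⟨h1 i s hs, (hab i s (by omega)).2⟩⟩
  · have h1 := h _ hx.neg (-b) ((b - a) / 2) σ (fun i s hs => neg_le_neg (hab i s hs).2) hw
      (by linarith)
    exact ⟨a, b - c * ((b - a) / 2), by linarith,
      fun i s hs => ⟨(hab i s (by omega)).1, by linarith [h1 i s hs]⟩⟩

/-- Delayed averaging over a graph with a root reaches consensus. -/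
theorem exists_tendsto [Fintype ι] (hx : IsDelayedAveraging Adj r D N κ x)
    (hroot : ∀ i, Relation.ReflTransGen Adj r i) :
    ∃ c, ∀ i, Tendsto (x i) atTop (𝓝 c) := by
  obtain ⟨S, c, hc0, hc1, h⟩ := hx.exists_contraction hroot
  obtain ⟨A, hA⟩ : ∃ A, ∀ i, |x i 0| ≤ A :=
    ⟨∑ i, |x i 0|, fun i => Finset.single_le_sum (f := fun i => |x i 0|)
      (fun i _ => abs_nonneg _) (Finset.mem_univ i)⟩
  have hstart : ∀ i s, 0 ≤ s + D → x i s ∈ Icc (-A) A := fun i s hs =>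
    ⟨hx.lower_bound_forever (σ := 0) (a := -A) (fun i s _ hs => by
        obtain rfl : s = 0 := by omega
        exact (abs_le.1 (hA i)).1) i s hs,
      neg_le_neg_iff.1 (hx.neg.lower_bound_forever (σ := 0) (a := -A) (fun i s _ hs => by
        obtain rfl : s = 0 := by omega
        exact neg_le_neg (abs_le.1 (hA i)).2) i s hs)⟩
  have hiter : ∀ k : ℕ, ∃ a b : ℝ, b - a ≤ c ^ k * (2 * A) ∧
      ∀ i s, k * S ≤ s + D → x i s ∈ Icc a b := by
    intro k
    induction k with
    | zero => exact ⟨-A, A, by simp; linarith, fun i s _ => hstart i s (by omega)⟩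
    | succ k ih =>
      obtain ⟨a, b, hab, hbox⟩ := ih
      obtain ⟨a', b', hab', hbox'⟩ := h a b (k * S) hbox
      refine ⟨a', b', hab'.trans ?_, fun i s hs => hbox' i s (by rw [← Nat.succ_mul]; exact hs)⟩
      rw [pow_succ', mul_assoc]
      gcongr
  have hsmall : ∀ ε > 0, ∃ σ, ∀ i j s t, σ ≤ s → σ ≤ t → |x i s - x j t| < ε := by
    intro ε hε
    have hlim : Tendsto (fun k : ℕ => c ^ k * (2 * A)) atTop (𝓝 0) := by
      simpa using (tendsto_pow_atTop_nhds_zero_of_lt_one hc0 hc1).mul_const (2 * A)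
    obtain ⟨k, hk⟩ := (hlim.eventually (gt_mem_nhds hε)).exists
    obtain ⟨a, b, hab, hbox⟩ := hiter k
    refine ⟨k * S, fun i j s t hs ht => ?_⟩
    have h1 := hbox i s (by omega)
    have h2 := hbox j t (by omega)
    rw [abs_lt]
    constructor <;> linarith [h1.1, h1.2, h2.1, h2.2]
  obtain ⟨l, hl⟩ : ∃ l, Tendsto (x r) atTop (𝓝 l) := by
    refine cauchySeq_tendsto_of_complete (Metric.cauchySeq_iff.2 fun ε hε => ?_)
    obtain ⟨σ, hσ⟩ := hsmall ε hε
    exact ⟨σ, fun s hs t ht => by simpa [Real.dist_eq] using hσ r r s t hs ht⟩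
  refine ⟨l, fun i => ?_⟩
  have hdiff : Tendsto (fun σ => x i σ - x r σ) atTop (𝓝 0) := by
    refine Metric.tendsto_atTop.2 fun ε hε => ?_
    obtain ⟨σ, hσ⟩ := hsmall ε hε
    exact ⟨σ, fun s hs => by simpa [Real.dist_eq] using hσ i r s s hs hs⟩
  simpa using hdiff.add hl

end IsDelayedAveraging

/-! ### Delivered time stamps -/

theorem le_of_mem_deliveredStamps {T : ℝ} (hT : 0 < T) {τ : ℕ → ℝ≥0∞} {σ k : ℕ}
    (hk : k ∈ deliveredStamps T τ (σ * T)) : k ≤ σ := by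
  have h0 : 0 ≤ (τ k).toReal := ENNReal.toReal_nonneg
  have h1 : (k : ℝ) * T ≤ σ * T := by linarith [hk.2]
  exact_mod_cast le_of_mul_le_mul_right h1 hT

theorem exists_latestStamp_eq {T : ℝ} (hT : 0 < T) {τ : ℕ → ℝ≥0∞} {t : ℝ} {k : ℕ}
    (hk : k ∈ deliveredStamps T τ t) :
    ∃ q : ℕ, latestStamp T τ t = (q : WithBot ℕ) ∧ k ≤ q := by
  have hne : (deliveredStamps T τ t).Nonempty := ⟨k, hk⟩
  have hbdd := bddAbove_deliveredStamps hT τ t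
  exact ⟨sSup (deliveredStamps T τ t), (latestStamp_eq_coe_iff hT τ t _).2
    ⟨Nat.sSup_mem hne hbdd, fun x hx => le_csSup hbdd hx⟩, le_csSup hbdd hk⟩

theorem latestStamp_le {T : ℝ} (hT : 0 < T) (τ : ℕ → ℝ≥0∞) (σ : ℕ) :
    latestStamp T τ (σ * T) ≤ (σ : WithBot ℕ) := by
  cases h : latestStamp T τ (σ * T) with
  | bot => exact bot_le
  | coe k =>
    exact Nat.cast_le.2 (le_of_mem_deliveredStamps hT
      ((latestStamp_eq_coe_iff hT τ _ k).1 h).1)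

/-- Under the communication assumption, the latest data is eventually never older than a fixed
number `D` of periods. -/
theorem CommunicationAssumption.exists_latestStamp_ge {n : ℕ} {G : Digraph (Fin n)}
    {τ : Fin n → Fin n → ℕ → ℝ≥0∞} (hτ : CommunicationAssumption G τ) {T : ℝ} (hT : 0 < T)
    {i j : Fin n} (hji : G.Adj j i) :
    ∃ D : ℕ, ∀ σ, D ≤ σ → ((σ - D : ℕ) : WithBot ℕ) ≤ latestStamp T (τ j i) (σ * T) := by
  obtain ⟨kstar, h, K, hh, hK, hK0, hgap, hdelay⟩ := hτ j i hji
  have hceil : h ≤ ⌈h / T⌉₊ * T := (div_le_iff₀ hT).1 (Nat.le_ceil _)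
  generalize ⌈h / T⌉₊ = H at hceil
  refine ⟨H + kstar, fun σ hσ => ?_⟩
  -- `K l` is the last guaranteed stamp whose data has certainly arrived by the time `σ * T`.
  obtain ⟨l, hl, hl'⟩ : ∃ l, K l + H ≤ σ ∧ σ < K (l + 1) + H := by
    have hex : ∃ l, σ < K l + H := ⟨σ + 1, by have := hK.le_apply (x := σ + 1); omega⟩
    classical
    obtain ⟨l, hl⟩ : ∃ l, Nat.find hex = l + 1 := by
      refine Nat.exists_eq_succ_of_ne_zero fun h0 => ?_
      have := Nat.find_spec hex
      rw [h0] at this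
      omega
    refine ⟨l, not_lt.1 (Nat.find_min hex (by omega)), ?_⟩
    rw [← hl]
    exact Nat.find_spec hex
  have hmem : K l ∈ deliveredStamps T (τ j i) (σ * T) := by
    refine ⟨ne_top_of_le_ne_top ENNReal.ofReal_ne_top (hdelay l), ?_⟩
    have h1 : (τ j i (K l)).toReal ≤ h := ENNReal.toReal_le_of_le_ofReal hh (hdelay l)
    have h2 : ((K l : ℝ) + H) * T ≤ σ * T := by
      gcongr
      exact_mod_cast hl
    nlinarith
  obtain ⟨q, hq, hlq⟩ := exists_latestStamp_eq hT hmem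
  rw [hq]
  have := hgap l
  exact Nat.cast_le.2 (by omega)

/-- Under the communication assumption there is a common bound on the staleness of the data that
arrives and on the waiting time between arrivals of fresh data, for all edges at once. -/
theorem CommunicationAssumption.exists_bound {n : ℕ} {G : Digraph (Fin n)}
    {τ : Fin n → Fin n → ℕ → ℝ≥0∞} (hτ : CommunicationAssumption G τ) {T : ℝ} (hT : 0 < T) :
    ∃ D : ℕ, ∀ i j, G.Adj j i →
      (∀ σ k : ℕ, latestStamp T (τ j i) (σ * T) = (k : WithBot ℕ) → σ ≤ k + D) ∧
      ∀ s, ∃ q, s ≤ q ∧ q ≤ s + D ∧ j ∈ updateSet G T τ i q := by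
  classical
  have hex : ∀ e : Fin n × Fin n, ∃ D : ℕ, G.Adj e.2 e.1 → ∀ σ, D ≤ σ →
      ((σ - D : ℕ) : WithBot ℕ) ≤ latestStamp T (τ e.2 e.1) (σ * T) := by
    intro e
    by_cases he : G.Adj e.2 e.1
    · obtain ⟨D, hD⟩ := hτ.exists_latestStamp_ge hT he
      exact ⟨D, fun _ => hD⟩
    · exact ⟨0, fun h => absurd h he⟩
  choose D hD using hex
  refine ⟨Finset.univ.sup D + 1, fun i j hji => ?_⟩
  have hle : D (i, j) ≤ Finset.univ.sup D := Finset.le_sup (Finset.mem_univ _)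
  have hlow := hD (i, j) hji
  dsimp only at hlow
  refine ⟨fun σ k hk => ?_, fun s => ?_⟩
  · rcases lt_or_ge σ (D (i, j)) with hσ | hσ
    · omega
    · have := hlow σ hσ
      rw [hk] at this
      have := Nat.cast_le.1 this
      omega
  · by_contra! hno
    -- Without fresh data the latest stamp could not have grown beyond its value at time `s * T`.
    have hstay : ∀ p, p ≤ D (i, j) + 1 →
        latestStamp T (τ j i) ((s + p : ℕ) * T) ≤ (s : WithBot ℕ) := by
      intro p
      induction p with
      | zero => exact fun _ => latestStamp_le hT _ s
      | succ p ih =>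
        intro hp
        have h1 := hno (s + (p + 1)) (by omega) (by omega)
        simp only [updateSet, Finset.mem_insert, Finset.mem_filter, Finset.mem_univ, true_and,
          not_or, not_and, not_lt] at h1
        have h2 := h1.2 hji
        rw [show (((s + (p + 1) : ℕ) : ℝ) - 1) = ((s + p : ℕ) : ℝ) by push_cast; ring] at h2
        exact h2.trans (ih (by omega))
    have h1 := hlow (s + (D (i, j) + 1)) (by omega)
    have h2 := Nat.cast_le.1 (h1.trans (hstay _ le_rfl))
    omega

/-! ### The second-order filter -/

/-- A function with a right derivative at most `-c V + ε` is eventually at most about `ε / c`. -/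
theorem le_exp_decay_add {V V' : ℝ → ℝ} {a c ε : ℝ} (hc : 0 < c) (hε : 0 ≤ ε)
    (hcont : ContinuousOn V (Ici a)) (hderiv : ∀ t, a ≤ t → HasDerivWithinAt V (V' t) (Ici t) t)
    (hbound : ∀ t, a ≤ t → V' t ≤ -c * V t + ε) {t : ℝ} (ht : a ≤ t) :
    V t ≤ V a * Real.exp (-c * (t - a)) + ε / c := by
  have h := le_gronwallBound_of_liminf_deriv_right_le (f := V) (f' := V') (δ := V a) (K := -c)
    (ε := ε) (a := a) (b := t) (hcont.mono Icc_subset_Ici_self)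
    (fun x hx r hr => by
      simpa [slope_def_field, div_eq_inv_mul] using (hderiv x hx.1).liminf_right_slope_le hr)
    le_rfl (fun x hx => hbound x hx.1) t ⟨ht, le_rfl⟩
  rw [gronwallBound_of_K_ne_0 (neg_ne_zero.2 hc.ne')] at h
  refine h.trans ?_
  have h1 : 0 ≤ ε / c * Real.exp (-c * (t - a)) := by positivity
  have h2 : ε / -c = -(ε / c) := div_neg ε
  rw [h2]
  linarith

section Lyapunov

variable {E : Type*} [NormedAddCommGroup E] [InnerProductSpace ℝ E]

/-- Lyapunov function of the oscillator with damping `kd` and stiffness `kp`, at position `e` and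
velocity `p`. The term in `p + kd • e` makes its derivative along the unforced motion negative
definite without cross terms. -/
def filterEnergy (kd kp : ℝ) (e p : E) : ℝ :=
  ‖p + kd • e‖ ^ 2 + ‖p‖ ^ 2 + 2 * kp * ‖e‖ ^ 2

theorem norm_sq_velocity_le_filterEnergy {kd kp : ℝ} (hkp : 0 < kp) (e p : E) :
    ‖p‖ ^ 2 ≤ filterEnergy kd kp e p := by
  unfold filterEnergy
  nlinarith [sq_nonneg ‖p + kd • e‖, sq_nonneg ‖e‖]

theorem norm_sq_position_le_filterEnergy {kd kp : ℝ} (e p : E) :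
    2 * kp * ‖e‖ ^ 2 ≤ filterEnergy kd kp e p := by
  unfold filterEnergy
  nlinarith [sq_nonneg ‖p + kd • e‖, sq_nonneg ‖p‖]

theorem filterEnergy_le {kd kp : ℝ} (hkp : 0 < kp) (e p : E) :
    filterEnergy kd kp e p ≤ (3 + 2 * kd ^ 2 / kp) * (‖p‖ ^ 2 + kp * ‖e‖ ^ 2) := by
  have h1 : ‖p + kd • e‖ ^ 2 ≤ 2 * ‖p‖ ^ 2 + 2 * kd ^ 2 * ‖e‖ ^ 2 := by
    have h := parallelogram_law_with_norm ℝ p (kd • e)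
    have h2 : ‖kd • e‖ ^ 2 = kd ^ 2 * ‖e‖ ^ 2 := by rw [norm_smul, mul_pow, Real.norm_eq_abs, sq_abs]
    nlinarith [sq_nonneg ‖p - kd • e‖]
  have h3 : (3 + 2 * kd ^ 2 / kp) * (‖p‖ ^ 2 + kp * ‖e‖ ^ 2) = 3 * ‖p‖ ^ 2 + 3 * kp * ‖e‖ ^ 2 +
      2 * kd ^ 2 * ‖e‖ ^ 2 + 2 * kd ^ 2 / kp * ‖p‖ ^ 2 := by
    field_simp
    ring
  have h4 : 0 ≤ 2 * kd ^ 2 / kp * ‖p‖ ^ 2 := by positivity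
  have h5 : 0 ≤ kp * ‖e‖ ^ 2 := by positivity
  unfold filterEnergy
  linarith

/-- The derivative of `filterEnergy` along the oscillator forced by `w`, and its dissipation bound. -/
theorem exists_hasDerivWithinAt_filterEnergy {kd kp : ℝ} (hkd : 0 < kd) (hkp : 0 < kp)
    {e p : ℝ → E} {w : E} {s : Set ℝ} {t : ℝ} (he : HasDerivWithinAt e (p t) s t)
    (hp : HasDerivWithinAt p (-(kd • p t) - kp • (e t - w)) s t) :
    ∃ V' : ℝ, HasDerivWithinAt (fun x => filterEnergy kd kp (e x) (p x)) V' s t ∧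
      V' ≤ -(kd / (3 + 2 * kd ^ 2 / kp)) * filterEnergy kd kp (e t) (p t) +
        (4 * kp ^ 2 / kd + kp * kd) * ‖w‖ ^ 2 := by
  have hq : HasDerivWithinAt (fun x => p x + kd • e x) (-(kp • (e t - w))) s t := by
    convert hp.add (he.const_smul kd) using 1
    · rfl
    · abel
  refine ⟨_, (hq.norm_sq.add hp.norm_sq).add (he.norm_sq.const_mul (2 * kp)), ?_⟩
  have hA : 0 < 3 + 2 * kd ^ 2 / kp := by positivity
  have hV : -(kd * (‖p t‖ ^ 2 + kp * ‖e t‖ ^ 2)) ≤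
      -(kd / (3 + 2 * kd ^ 2 / kp)) * filterEnergy kd kp (e t) (p t) := by
    rw [neg_mul, neg_le_neg_iff, div_mul_eq_mul_div, div_le_iff₀ hA]
    nlinarith [mul_le_mul_of_nonneg_left (filterEnergy_le (kd := kd) hkp (e t) (p t)) hkd.le]
  have hpw : 4 * kp * (‖p t‖ * ‖w‖) ≤ kd * ‖p t‖ ^ 2 + 4 * kp ^ 2 / kd * ‖w‖ ^ 2 := by
    have h : kd * ‖p t‖ ^ 2 + 4 * kp ^ 2 / kd * ‖w‖ ^ 2 - 4 * kp * (‖p t‖ * ‖w‖) =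
        (kd * ‖p t‖ - 2 * kp * ‖w‖) ^ 2 / kd := by
      field_simp
      ring
    have : 0 ≤ (kd * ‖p t‖ - 2 * kp * ‖w‖) ^ 2 / kd := by positivity
    linarith
  have hew : 2 * (kp * kd) * (‖e t‖ * ‖w‖) ≤ kp * kd * ‖e t‖ ^ 2 + kp * kd * ‖w‖ ^ 2 := by
    nlinarith [mul_nonneg (mul_pos hkp hkd).le (sq_nonneg (‖e t‖ - ‖w‖))]
  have hpw' := mul_le_mul_of_nonneg_left (real_inner_le_norm (p t) w)
    (by positivity : 0 ≤ 4 * kp)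
  have hew' := mul_le_mul_of_nonneg_left (real_inner_le_norm (e t) w)
    (by positivity : 0 ≤ 2 * (kp * kd))
  simp only [inner_add_left, inner_sub_right, inner_neg_right, real_inner_smul_left,
    real_inner_smul_right, real_inner_self_eq_norm_sq, real_inner_comm (p t) (e t)]
  rw [real_inner_comm (e t) (p t)] at *
  linarith

/-- The damped oscillator is input-to-state stable: a bounded force gives a bounded motion, and a
force that vanishes at infinity gives a motion that does. -/
theorem damped_oscillator_bounded_and_tendsto {kd kp : ℝ} (hkd : 0 < kd) (hkp : 0 < kp)
    {e p w : ℝ → E} (he : ContinuousOn e (Ici 0)) (hp : ContinuousOn p (Ici 0))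
    (he' : ∀ t, 0 ≤ t → HasDerivWithinAt e (p t) (Ici t) t)
    (hp' : ∀ t, 0 ≤ t → HasDerivWithinAt p (-(kd • p t) - kp • (e t - w t)) (Ici t) t)
    {W : ℝ} (hW : ∀ t, 0 ≤ t → ‖w t‖ ≤ W) (hw : Tendsto w atTop (𝓝 0)) :
    (∃ C, ∀ t, 0 ≤ t → ‖e t‖ ≤ C ∧ ‖p t‖ ≤ C) ∧ Tendsto e atTop (𝓝 0) := by
  set V : ℝ → ℝ := fun x => filterEnergy kd kp (e x) (p x) with hVdef
  have hVcont : ContinuousOn V (Ici 0) := by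
    unfold V filterEnergy
    fun_prop
  set c := kd / (3 + 2 * kd ^ 2 / kp) with hcdef
  have hc : 0 < c := by positivity
  set B := 4 * kp ^ 2 / kd + kp * kd with hBdef
  have hB : 0 < B := by positivity
  have hex : ∀ t, ∃ V', 0 ≤ t → HasDerivWithinAt V V' (Ici t) t ∧ V' ≤ -c * V t + B * ‖w t‖ ^ 2 := by
    intro t
    rcases le_or_gt 0 t with ht | ht
    · obtain ⟨V', h1, h2⟩ := exists_hasDerivWithinAt_filterEnergy hkd hkp (he' t ht) (hp' t ht)
      exact ⟨V', fun _ => ⟨h1, h2⟩⟩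
    · exact ⟨0, fun h => absurd h (not_le.2 ht)⟩
  choose V' hV' using hex
  have hdecay : ∀ a ε, 0 ≤ a → 0 ≤ ε → (∀ t, a ≤ t → B * ‖w t‖ ^ 2 ≤ ε) → ∀ t, a ≤ t →
      V t ≤ V a * Real.exp (-c * (t - a)) + ε / c := by
    intro a ε ha hε hwε t ht
    exact le_exp_decay_add hc hε (hVcont.mono (Ici_subset_Ici.2 ha))
      (fun t ht => (hV' t (ha.trans ht)).1)
      (fun t ht => ((hV' t (ha.trans ht)).2).trans (by linarith [hwε t ht])) ht
  have hVnonneg : ∀ t, 0 ≤ V t := fun t =>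
    (sq_nonneg _).trans (norm_sq_velocity_le_filterEnergy hkp (e t) (p t))
  have hVlim : Tendsto V atTop (𝓝 0) := by
    refine Metric.tendsto_atTop.2 fun ε hε => ?_
    have hforce : Tendsto (fun t => B * ‖w t‖ ^ 2) atTop (𝓝 0) := by
      simpa using (hw.norm.pow 2).const_mul B
    obtain ⟨a, ha⟩ := eventually_atTop.1
      (hforce.eventually (gt_mem_nhds (by positivity : 0 < ε / 2 * c)))
    have hexp : Tendsto (fun t => V (max a 0) * Real.exp (-c * (t - max a 0))) atTop (𝓝 0) := by
      have h1 : Tendsto (fun t : ℝ => -c * (t - max a 0)) atTop atBot :=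
        (tendsto_atTop_add_const_right atTop (-max a 0) tendsto_id).const_mul_atTop_of_neg
          (neg_lt_zero.2 hc)
      simpa using (Real.tendsto_exp_atBot.comp h1).const_mul (V (max a 0))
    obtain ⟨b, hb⟩ := eventually_atTop.1
      (hexp.eventually (gt_mem_nhds (by positivity : 0 < ε / 2)))
    refine ⟨max b (max a 0), fun t ht => ?_⟩
    have h1 := hdecay (max a 0) (ε / 2 * c) (le_max_right _ _) (by positivity)
      (fun t ht => (ha t ((le_max_left _ _).trans ht)).le) t ((le_max_right _ _).trans ht)
    have h2 := hb t ((le_max_left _ _).trans ht)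
    rw [mul_div_cancel_right₀ _ hc.ne'] at h1
    rw [Real.dist_eq, sub_zero, abs_of_nonneg (hVnonneg t)]
    linarith
  refine ⟨?_, ?_⟩
  · have hVbound : ∀ t, 0 ≤ t → V t ≤ V 0 + B * W ^ 2 / c := by
      intro t ht
      have hforce : ∀ t, 0 ≤ t → B * ‖w t‖ ^ 2 ≤ B * W ^ 2 := fun t ht => by
        gcongr
        exact hW t ht
      refine (hdecay 0 (B * W ^ 2) le_rfl (by positivity) hforce t ht).trans ?_
      have hexp : Real.exp (-c * (t - 0)) ≤ 1 :=
        Real.exp_le_one_iff.2 (by nlinarith)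
      linarith [mul_le_of_le_one_right (hVnonneg 0) hexp]
    set M := V 0 + B * W ^ 2 / c
    refine ⟨Real.sqrt (M / (2 * kp)) + Real.sqrt M, fun t ht => ⟨?_, ?_⟩⟩
    · have h1 : ‖e t‖ ≤ Real.sqrt (M / (2 * kp)) := by
        refine Real.le_sqrt_of_sq_le ?_
        rw [le_div_iff₀' (by positivity)]
        exact (norm_sq_position_le_filterEnergy (e t) (p t)).trans (hVbound t ht)
      linarith [Real.sqrt_nonneg M]
    · have h1 : ‖p t‖ ≤ Real.sqrt M :=
        Real.le_sqrt_of_sq_le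
          ((norm_sq_velocity_le_filterEnergy hkp (e t) (p t)).trans (hVbound t ht))
      linarith [Real.sqrt_nonneg (M / (2 * kp))]
  · have hsq : Tendsto (fun t => ‖e t‖ ^ 2) atTop (𝓝 0) := by
      refine squeeze_zero (fun t => sq_nonneg _) (fun t => ?_)
        (by simpa using hVlim.div_const (2 * kp))
      rw [le_div_iff₀' (by positivity)]
      exact norm_sq_position_le_filterEnergy (e t) (p t)
    refine tendsto_zero_iff_norm_tendsto_zero.2 ?_
    simpa using hsq.sqrt

end Lyapunov

/-! ### Consensus of the estimates and convergence of the filter -/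

theorem IsRootedAt.reflTransGen {n : ℕ} {G : Digraph (Fin n)} {r : Fin n} (hr : IsRootedAt G r)
    (i : Fin n) : Relation.ReflTransGen G.Adj r i := by
  rcases eq_or_ne i r with rfl | hi
  · exact .refl
  · exact (hr i hi).to_reflTransGen

namespace IsConsensusTrajectory

variable {n m : ℕ} {G : Digraph (Fin n)} {L : Set (Fin n)} {T : ℝ}
  {τ : Fin n → Fin n → ℕ → ℝ≥0∞} {vd : EuclideanSpace ℝ (Fin m)}
  {vhat : Fin n → ℕ → EuclideanSpace ℝ (Fin m)}

open Classical in
/-- Every coordinate of a trajectory is a delayed averaging process, in which a leader averages over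
itself alone and therefore copies the root, which is a leader as soon as there is one. -/
theorem exists_isDelayedAveraging (hv : IsConsensusTrajectory G L T τ vd vhat) (hT : 0 < T)
    (hτ : CommunicationAssumption G τ) {r : Fin n} (hrL : L.Nonempty → r ∈ L) :
    ∃ (D : ℕ) (N : Fin n → ℕ → Finset (Fin n)) (κ : Fin n → Fin n → ℕ → ℕ),
      ∀ c, IsDelayedAveraging G.Adj r D N κ fun i σ => vhat i σ c := by
  obtain ⟨D, hD⟩ := hτ.exists_bound hT
  let N : Fin n → ℕ → Finset (Fin n) := fun i σ => if i ∈ L then {i} else updateSet G T τ i σ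
  let κ : Fin n → Fin n → ℕ → ℕ := fun i j σ =>
    if j = i then σ else (latestStamp T (τ j i) (σ * T)).unbotD 0
  have hself : ∀ i σ, i ∈ N i σ := by
    intro i σ
    by_cases hi : i ∈ L <;> simp [N, hi, updateSet]
  have hκself : ∀ i σ, κ i i σ = σ := fun i σ => if_pos rfl
  have htime : ∀ i σ, ∀ j ∈ N i σ, κ i j σ ≤ σ ∧ σ ≤ κ i j σ + D := by
    intro i σ j hj
    rcases eq_or_ne j i with rfl | hji
    · rw [hκself]
      omega
    by_cases hi : i ∈ L
    · exact absurd (by simpa [N, hi] using hj) hji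
    have hmem : G.Adj j i ∧
        latestStamp T (τ j i) (((σ : ℝ) - 1) * T) < latestStamp T (τ j i) ((σ : ℝ) * T) := by
      simpa [N, hi, updateSet, hji] using hj
    obtain ⟨k, hk⟩ := WithBot.ne_bot_iff_exists.1 hmem.2.ne_bot
    have hκ : κ i j σ = k := by simp [κ, hji, ← hk]
    have hle := latestStamp_le hT (τ j i) σ
    rw [← hk] at hle
    rw [hκ]
    exact ⟨Nat.cast_le.1 hle, (hD i j hmem.1).1 σ k hk.symm⟩
  refine ⟨D, N, κ, fun c => ⟨hself, hκself, fun i σ j hj => (htime i σ j hj).1,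
    fun i σ j hj => (htime i σ j hj).2, fun i σ => ?_, fun i j hij => ?_⟩⟩
  · by_cases hi : i ∈ L
    · simp [N, hi, hκself, hv.leader i hi]
    · have hreceived : ∀ j, receivedEstimate T τ vhat i j σ = vhat j (κ i j σ) := by
        intro j
        by_cases hji : j = i
        · subst hji
          simp [receivedEstimate, κ]
        · simp [receivedEstimate, κ, hji]
      simp [hv.follower i hi σ, hreceived, N, hi]
  · by_cases hj : j ∈ L
    · exact .inl fun σ => by rw [hv.leader j hj, hv.leader r (hrL ⟨j, hj⟩)]
    · refine .inr fun s => ?_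
      simpa [N, hj] using (hD j i hij).2 s

theorem exists_tendsto (hv : IsConsensusTrajectory G L T τ vd vhat) (hT : 0 < T)
    (hτ : CommunicationAssumption G τ) {r : Fin n} (hr : IsRootedAt G r)
    (hrL : L.Nonempty → r ∈ L) :
    ∃ vc : EuclideanSpace ℝ (Fin m), ∀ i, Tendsto (vhat i) atTop (𝓝 vc) := by
  obtain ⟨D, N, κ, hx⟩ := hv.exists_isDelayedAveraging hT hτ hrL
  choose vc hvc using fun c => (hx c).exists_tendsto hr.reflTransGen
  refine ⟨WithLp.toLp 2 vc, fun i => ?_⟩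
  exact ((PiLp.continuous_toLp 2 _).tendsto vc).comp (tendsto_pi_nhds.2 fun c => hvc c i)

end IsConsensusTrajectory

/-- The velocity of the filter of a follower has a right derivative at all times, including the
sampling instants, because the input is constant on each sampling period. -/
theorem IsFilteredEstimate.hasDerivWithinAt_velocity {n m : ℕ} {L : Set (Fin n)} {T : ℝ}
    {kd kp : Fin n → ℝ} {vd : EuclideanSpace ℝ (Fin m)}
    {vhat : Fin n → ℕ → EuclideanSpace ℝ (Fin m)} {vbar : Fin n → ℝ → EuclideanSpace ℝ (Fin m)}
    (h : IsFilteredEstimate L T kd kp vd vhat vbar) (hT : 0 < T) {i : Fin n} (hi : i ∉ L) {t : ℝ}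
    (ht : 0 ≤ t) :
    HasDerivWithinAt (derivWithin (vbar i) (Ici 0))
      (-(kd i • derivWithin (vbar i) (Ici 0) t) - kp i • (vbar i t - vhat i ⌊t / T⌋₊))
      (Ici t) t := by
  have hcont : ContinuousOn (derivWithin (vbar i) (Ici 0)) (Ici 0) :=
    (h.contDiffOn i hi).continuousOn_derivWithin (uniqueDiffOn_Ici 0) le_rfl
  have hle : (⌊t / T⌋₊ : ℝ) * T ≤ t := (le_div_iff₀ hT).1 (Nat.floor_le (by positivity))
  have hlt : t < ((⌊t / T⌋₊ : ℝ) + 1) * T := (div_lt_iff₀ hT).1 (Nat.lt_floor_add_one _)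
  generalize ⌊t / T⌋₊ = σ at hle hlt ⊢
  have hsub : Ioo t (((σ : ℝ) + 1) * T) ⊆ Ici 0 := fun x hx => ht.trans hx.1.le
  have hode : ∀ x ∈ Ioo t (((σ : ℝ) + 1) * T), HasDerivAt (derivWithin (vbar i) (Ici 0))
      (-(kd i • derivWithin (vbar i) (Ici 0) x) - kp i • (vbar i x - vhat i σ)) x := by
    intro x hx
    have hσx : (σ : ℝ) * T < x := hle.trans_lt hx.1
    have hfloor : ⌊x / T⌋₊ = σ :=
      (Nat.floor_eq_iff (div_nonneg (ht.trans hx.1.le) hT.le)).2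
        ⟨(le_div_iff₀ hT).2 hσx.le, (div_lt_iff₀ hT).2 hx.2⟩
    have := h.ode i hi x (ht.trans_lt hx.1) (fun q hq => by
      rw [hq] at hσx
      have h1 : σ < q := by exact_mod_cast lt_of_mul_lt_mul_right hσx hT.le
      have h2 := lt_of_mul_lt_mul_right (hq ▸ hx.2) hT.le
      have h3 : q < σ + 1 := by exact_mod_cast h2
      omega)
    rwa [hfloor] at this
  have hnhds : Ioo t (((σ : ℝ) + 1) * T) ∈ 𝓝[>] t := Ioo_mem_nhdsGT hlt
  refine hasDerivWithinAt_Ici_of_tendsto_deriv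
    (fun x hx => (hode x hx).differentiableAt.differentiableWithinAt)
    ((hcont t ht).mono hsub) hnhds ?_
  have hlim : ContinuousWithinAt (fun x => -(kd i • derivWithin (vbar i) (Ici 0) x) -
      kp i • (vbar i x - vhat i σ)) (Ioi t) t := by
    have h1 := (hcont t ht).mono fun x (hx : t < x) => ht.trans hx.le
    have h2 := ((h.contDiffOn i hi).continuousOn t ht).mono fun x (hx : t < x) => ht.trans hx.le
    fun_prop
  refine hlim.tendsto.congr' ?_
  filter_upwards [hnhds] with x hx using (hode x hx).deriv.symm

theorem IsFilteredEstimate.bounded_and_tendsto {n m : ℕ} {L : Set (Fin n)} {T : ℝ}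
    {kd kp : Fin n → ℝ} {vd vc : EuclideanSpace ℝ (Fin m)}
    {vhat : Fin n → ℕ → EuclideanSpace ℝ (Fin m)} {vbar : Fin n → ℝ → EuclideanSpace ℝ (Fin m)}
    (h : IsFilteredEstimate L T kd kp vd vhat vbar) (hT : 0 < T) (hkd : ∀ i ∉ L, 0 < kd i)
    (hkp : ∀ i ∉ L, 0 < kp i) (hvc : ∀ i ∈ L, vc = vd)
    (hlim : ∀ i, Tendsto (vhat i) atTop (𝓝 vc)) :
    UniformlyBoundedWithDeriv vbar ∧ ∀ i, Tendsto (vbar i) atTop (𝓝 vc) := by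
  have key : ∀ i, (∃ C, ∀ t, 0 ≤ t →
      ‖vbar i t‖ ≤ C ∧ ‖derivWithin (vbar i) (Ici 0) t‖ ≤ C) ∧ Tendsto (vbar i) atTop (𝓝 vc) := by
    intro i
    by_cases hi : i ∈ L
    · have hconst := h.leader i hi
      refine ⟨⟨‖vd‖, fun t ht => ⟨(congrArg _ (hconst t ht)).le, ?_⟩⟩, ?_⟩
      · rw [derivWithin_congr (s := Ici 0) (f := fun _ => vd) (fun x hx => hconst x hx) (hconst t ht)]
        simp
      · rw [hvc i hi]
        refine tendsto_const_nhds.congr' ?_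
        filter_upwards [eventually_ge_atTop 0] with t ht using (hconst t ht).symm
    have hcd := h.contDiffOn i hi
    have hfloor : Tendsto (fun t : ℝ => ⌊t / T⌋₊) atTop atTop :=
      tendsto_nat_floor_atTop.comp (tendsto_id.atTop_div_const hT)
    obtain ⟨W, hW⟩ := (Metric.isBounded_range_of_tendsto _ ((hlim i).sub_const vc)).exists_norm_le
    obtain ⟨⟨C, hC⟩, hzero⟩ := damped_oscillator_bounded_and_tendsto (hkd i hi) (hkp i hi)
      (e := fun t => vbar i t - vc) (p := derivWithin (vbar i) (Ici 0))
      (w := fun t => vhat i ⌊t / T⌋₊ - vc) (hcd.continuousOn.sub continuousOn_const)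
      (hcd.continuousOn_derivWithin (uniqueDiffOn_Ici 0) le_rfl)
      (fun t ht => (((hcd.differentiableOn one_ne_zero t ht).hasDerivWithinAt).mono
        (Ici_subset_Ici.2 ht)).sub_const vc)
      (fun t ht => by simpa using h.hasDerivWithinAt_velocity hT hi ht)
      (fun t _ => hW _ (mem_range_self _))
      (by simpa using ((hlim i).comp hfloor).sub_const vc)
    refine ⟨⟨C + ‖vc‖, fun t ht => ⟨?_, ?_⟩⟩, by simpa using hzero.add_const vc⟩
    · have h1 := norm_add_le (vbar i t - vc) vc
      rw [sub_add_cancel] at h1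
      linarith [(hC t ht).1]
    · linarith [(hC t ht).2, norm_nonneg vc]
  choose C hC using fun i => (key i).1
  refine ⟨⟨∑ i, |C i|, fun i t ht => ?_⟩, fun i => (key i).2⟩
  have hle : C i ≤ ∑ i, |C i| := (le_abs_self _).trans
    (Finset.single_le_sum (f := fun i => |C i|) (fun i _ => abs_nonneg _) (Finset.mem_univ i))
  exact ⟨(hC i t ht).1.trans hle, (hC i t ht).2.trans hle⟩

theorem proposition1 {n m : ℕ} (G : Digraph (Fin n)) (L : Set (Fin n)) (T : ℝ) (hT : 0 < T)
    (τ : Fin n → Fin n → ℕ → ℝ≥0∞) (hτ : CommunicationAssumption G τ)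
    (vd : EuclideanSpace ℝ (Fin m)) (vhat : Fin n → ℕ → EuclideanSpace ℝ (Fin m))
    (hvhat : IsConsensusTrajectory G L T τ vd vhat) :
    ((∃ r ∈ L, IsRootedAt G r) →
      (∀ i, Tendsto (vhat i) atTop (𝓝 vd)) ∧
      ∀ (kd kp : Fin n → ℝ), (∀ i ∉ L, 0 < kd i) → (∀ i ∉ L, 0 < kp i) →
        ∀ vbar : Fin n → ℝ → EuclideanSpace ℝ (Fin m),
          IsFilteredEstimate L T kd kp vd vhat vbar →
            UniformlyBoundedWithDeriv vbar ∧ ∀ i, Tendsto (vbar i) atTop (𝓝 vd)) ∧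
    (L = ∅ → (∃ r, IsRootedAt G r) →
      ∃ vc : EuclideanSpace ℝ (Fin m),
        (∀ i, Tendsto (vhat i) atTop (𝓝 vc)) ∧
        ∀ (kd kp : Fin n → ℝ), (∀ i ∉ L, 0 < kd i) → (∀ i ∉ L, 0 < kp i) →
          ∀ vbar : Fin n → ℝ → EuclideanSpace ℝ (Fin m),
            IsFilteredEstimate L T kd kp vd vhat vbar →
              UniformlyBoundedWithDeriv vbar ∧ ∀ i, Tendsto (vbar i) atTop (𝓝 vc)) := by
  constructor
  · rintro ⟨r, hrL, hr⟩
    obtain ⟨vc, hvc⟩ := hvhat.exists_tendsto hT hτ hr fun _ => hrL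
    obtain rfl : vc = vd := by
      refine tendsto_nhds_unique (hvc r) ?_
      rw [show vhat r = fun _ => vd from funext (hvhat.leader r hrL)]
      exact tendsto_const_nhds
    exact ⟨hvc, fun kd kp hkd hkp vbar h =>
      h.bounded_and_tendsto hT hkd hkp (fun _ _ => rfl) hvc⟩
  · rintro rfl ⟨r, hr⟩
    obtain ⟨vc, hvc⟩ := hvhat.exists_tendsto hT hτ hr fun h => absurd h not_nonempty_empty
    exact ⟨vc, hvc, fun kd kp hkd hkp vbar h =>
      h.bounded_and_tendsto hT hkd hkp (fun i hi => absurd hi (notMem_empty i)) hvc⟩
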